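/- Let $\mathcal{A}$ be a finite discrete alphabet. A shift on $\mathcal{A}$ is a nonempty compact $X \subseteq \mathcal{A}^{\mathbb{Z}}$ with $TX = X$, where $(Tx)(j) = x(j+1)$. It is a $1$-step shift of finite type if there is $\mathcal{F} \subseteq \mathcal{A}^2$ such that $X = \{x \in \mathcal{A}^{\mathbb{Z}} : (x(j), x(j+1)) \notin \mathcal{F} \text{ for all } j \in \mathbb{Z}\}$. It is called transitive if there is $D \in \mathbb{N}$ such that for all $x_1, x_2 \in X$ and all $b_1, a_2 \in \mathbb{Z}$ with $a_2 - b_1 \geq D$ there is $x' \in X$ with $x'(j) = x_1(j)$ for all $j \leq b_1$ and $x'(j) = x_2(j)$ for all $j \geq a_2$. Let $(X, T)$ and $(Y, S)$ be transitive $1$-step shifts of finite type on $\mathcal{A}$, and let $f \in C(X \times Y)$ be a real-valued function for which there is $F : \mathcal{A}^2 \to \mathbb{R}$ with $f(x, y) = F(x(0), y(0))$ for all $(x, y) \in X \times Y$. Let $\mathcal{M}_S(Y)$ and $\mathcal{M}_{T \times S}(X \times Y)$ be the sets of invariant Borel probability measures. Let $\pi_Y : X \times Y \to Y$ be the projection.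 For $\nu \in \mathcal{M}_S(Y)$ put $$\psi_f(\nu) = \min\left\{ \int f \, \mathrm{d}\lambda : \lambda \in \mathcal{M}_{T \times S}(X \times Y), \ (\pi_Y)_* \lambda = \nu \right\}.$$ A measure $\nu_0 \in \mathcal{M}_S(Y)$ is $\alpha$-maximizing if $\psi_f(\nu) \leq \psi_f(\nu_0)$ for all $\nu \in \mathcal{M}_S(Y)$. Let $\mathcal{M}_S^{co}(Y)$ be the set of measures $\frac{1}{k} \sum_{j=0}^{k-1} \delta_{S^j y}$ with $k \geq 1$, $y \in Y$ and $S^k y = y$. For integers $a \leq b$ let $P_{a,b} = \{(x(a), x(b)) : x \in X\}$. For $(v_1, v_2) \in P_{a,b}$ and $y \in Y$ let $$H_{a,b,v_1,v_2}(y) = \min\left\{ \sum_{j=a}^{b} f(T^j x, S^j y) : x \in X, \ x(a) = v_1, \ x(b) = v_2 \right\}.$$ For $C \geq 0$, a point $y' \in Y$ is an $(f, C)$-improvement of $y \in Y$ on $[a, b]$ if $y'(j) = y(j)$ for all $j \in \mathbb{Z} \setminus [a, b]$ and $H_{a,b,v_1,v_2}(y) + C < H_{a,b,v_1,v_2}(y')$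 for all $(v_1, v_2) \in P_{a,b}$. Let $Y_{f,C}$ be the set of all $y \in Y$ that have no $(f, C)$-improvement on any $[a, b]$ with $a \leq b$. Then for each $C \geq 0$ the following conditions are equivalent: 1. There exists $\nu_0 \in \mathcal{M}_S^{co}(Y)$ which is $\alpha$-maximizing. 2. $Y_{f,C}$ contains a periodic point, i.e. a point $y$ with $S^k y = y$ for some $k \geq 1$. -/

import Mathlib

open MeasureTheory

noncomputable section

namespace AdversarialErgodic

/-! ### Invariant measures and maximizing measures -/

section Dynamics

variable {Y Z : Type*} [TopologicalSpace Y] [MeasurableSpace Y] [TopologicalSpace Z]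
  [MeasurableSpace Z]

/-- The invariant (Borel) probability measures of the system `(Z, U)`. -/
def invariantMeasures (U : Z ≃ₜ Z) : Set (Measure Z) :=
  {μ | IsProbabilityMeasure μ ∧ MeasurePreserving U μ μ}

/-- The average `𝔸_k μ = (1 / k) ∑_{j < k} (U ^ j)_* μ`. -/
def averageMeasure (U : Z ≃ₜ Z) (k : ℕ) (μ : Measure Z) : Measure Z :=
  (k : ENNReal)⁻¹ • ∑ j ∈ Finset.range k, μ.map (U^[j])

/-- The invariant probability measures supported on a periodic orbit: the measures
`𝔸_k δ_z` with `k ≥ 1` and `U ^ k z = z`. -/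
def closedOrbitMeasures (U : Z ≃ₜ Z) : Set (Measure Z) :=
  {μ | μ ∈ invariantMeasures U ∧ ∃ k : ℕ, 0 < k ∧ ∃ z : Z, Function.IsPeriodicPt U k z ∧
    μ = averageMeasure U k (Measure.dirac z)}

/-- `ψ_f(ν)`: the minimum of `∫ f dλ` over the `U`-invariant probability measures `λ` on `Z`
whose image under `π` is `ν`. -/
def psi (U : Z ≃ₜ Z) (π : Z → Y) (f : C(Z, ℝ)) (ν : Measure Y) : ℝ :=
  sInf ((fun μ : Measure Z => ∫ z, f z ∂μ) '' {μ | μ ∈ invariantMeasures U ∧ μ.map π = ν})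

/-- `ν₀` is `α`-maximizing: it is an `S`-invariant probability measure at which `ψ_f` attains its
supremum over all `S`-invariant probability measures. -/
def IsAlphaMaximizing (U : Z ≃ₜ Z) (S : Y ≃ₜ Y) (π : Z → Y) (f : C(Z, ℝ)) (ν₀ : Measure Y) :
    Prop :=
  ν₀ ∈ invariantMeasures S ∧ ∀ ν ∈ invariantMeasures S, psi U π f ν ≤ psi U π f ν₀

/-- The orbit sum `𝕊_{[a, b]} f = ∑_{a ≤ j ≤ b} f ∘ U ^ j`. -/
def orbitSum (U : Z ≃ₜ Z) (f : C(Z, ℝ)) (a b : ℤ) (z : Z) : ℝ :=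
  ∑ j ∈ Finset.Icc a b, f ((U ^ j) z)

end Dynamics

/-! ### Shifts -/

/-- The left shift `(T x) j = x (j + 1)` on `A^ℤ`. -/
def leftShift (A : Type*) [TopologicalSpace A] : (ℤ → A) ≃ₜ (ℤ → A) where
  toFun x j := x (j + 1)
  invFun x j := x (j - 1)
  left_inv x := by funext j; simp
  right_inv x := by funext j; simp
  continuous_toFun := by fun_prop
  continuous_invFun := by fun_prop

/-- A shift on `A`: a nonempty compact `X ⊆ A^ℤ` with `T X = X`. -/
structure Subshift (A : Type*) [TopologicalSpace A] where
  carrier : Set (ℤ → A)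
  nonempty : carrier.Nonempty
  isCompact : IsCompact carrier
  image_shift : leftShift A '' carrier = carrier

namespace Subshift

variable {A : Type*} [TopologicalSpace A]

instance : CoeSort (Subshift A) (Type _) := ⟨fun X => X.carrier⟩

theorem mem_iff_shift_mem (X : Subshift A) (x : ℤ → A) :
    x ∈ X.carrier ↔ leftShift A x ∈ X.carrier := by
  conv_rhs => rw [← X.image_shift]
  exact ((leftShift A).injective.mem_set_image).symm

/-- The left shift as a homeomorphism of the shift space `X`. -/
def shift (X : Subshift A) : X ≃ₜ X :=
  (leftShift A).subtype X.mem_iff_shift_mem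

/-- `X` is an `M`-step shift of finite type: it is given by a set of forbidden words of length
`M + 1`. -/
def IsStepSFT (X : Subshift A) (M : ℕ) : Prop :=
  ∃ 𝓕 : Set (Fin (M + 1) → A),
    X.carrier = {x | ∀ j : ℤ, (fun i : Fin (M + 1) => x (j + (i : ℕ))) ∉ 𝓕}

/-- Transitivity of a shift, in the uniform form: any left half of a point can be glued to any
right half of another point across any gap of length at least a constant `D`. -/
def IsTransitive (X : Subshift A) : Prop :=
  ∃ D : ℕ, ∀ x₁ x₂ : X, ∀ b₁ a₂ : ℤ, (D : ℤ) ≤ a₂ - b₁ →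
    ∃ x' : X, (∀ j ≤ b₁, x'.1 j = x₁.1 j) ∧ (∀ j ≥ a₂, x'.1 j = x₂.1 j)

end Subshift

/-! ### Improvements and generalized ground states -/

section GroundStates

variable {A : Type*} [TopologicalSpace A]

/-- `P_{a, b}`: the pairs of letters that occur at positions `a` and `b` of a point of `X`. -/
def endpointPairs (X : Subshift A) (a b : ℤ) : Set (A × A) :=
  {v | ∃ x : X, x.1 a = v.1 ∧ x.1 b = v.2}

/-- `H_{a, b, v₁, v₂}(y)`: the minimum of `𝕊_{[a, b]} f (x, y)` over the `x ∈ X` with `x a = v₁`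
and `x b = v₂`. -/
def minSum (X Y : Subshift A) (f : C(X × Y, ℝ)) (a b : ℤ) (v : A × A) (y : Y) : ℝ :=
  sInf ((fun x : X => orbitSum (X.shift.prodCongr Y.shift) f a b (x, y)) ''
    {x | x.1 a = v.1 ∧ x.1 b = v.2})

/-- `y'` is an `(f, C)`-improvement of `y` on `[a, b]`. -/
def IsImprovement (X Y : Subshift A) (f : C(X × Y, ℝ)) (C : ℝ) (a b : ℤ) (y y' : Y) : Prop :=
  (∀ j : ℤ, j ∉ Set.Icc a b → y.1 j = y'.1 j) ∧
    ∀ v ∈ endpointPairs X a b, minSum X Y f a b v y + C < minSum X Y f a b v y'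

/-- `Y_{f, C}`: the points of `Y` that cannot be `(f, C)`-improved on any `[a, b]`, `a ≤ b`. -/
def groundStates (X Y : Subshift A) (f : C(X × Y, ℝ)) (C : ℝ) : Set Y :=
  {y | ∀ a b : ℤ, a ≤ b → ¬ ∃ y' : Y, IsImprovement X Y f C a b y y'}

end GroundStates

end AdversarialErgodic

end

open AdversarialErgodic

noncomputable section

namespace AdversarialErgodic

/-! ### Cutting and pasting points of a shift -/

section Words

variable {A : Type*} [TopologicalSpace A]

/-! Both implications compare `n * psi` with `blockMin X F n`, the least cost over `[0, n)` with
free end letters. By `exists_abs_mul_psi_sub_le`, `n ψ_f(ν)` equals the `ν`-integral of `blockMin`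
up to an error independent of `n` and `ν`; by `abs_integral_blockMin_sub_le`, for the measure on a
periodic orbit that integral is the value at one point up to an error independent of `n`. So a
strict inequality between values of `ψ_f` amounts to a linearly growing gap between block minima.

If a periodic ground state were not maximizing, some `z` would have a block minimum far above that
of `y`. Gluing that block of `z` into `y` costs only boundary terms, so it beats any fixed `C`
(`exists_isImprovement`).

Conversely, suppose a periodic `y` with maximizing orbit measure has an improvement. As there are
finitely many end pairs, the gain is at least some `δ > 0` (`IsImprovement.exists_gap`). Repeating
the improved window periodically gives a periodic point of `Y`, and every repetition gains `δ`
(`IsImprovement.exists_block`, `blockMin_add_le_of_block`), so its orbit measure has larger `ψ_f`.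
-/

theorem Subshift.translate_mem (X : Subshift A) {x : ℤ → A} (hx : x ∈ X.carrier) (i : ℤ) :
    (fun j => x (j + i)) ∈ X.carrier := by
  induction i using Int.induction_on with
  | zero => simpa using hx
  | succ n ih =>
    have h := (X.mem_iff_shift_mem _).1 ih
    have e : leftShift A (fun j => x (j + (n : ℤ))) = fun j => x (j + ((n : ℤ) + 1)) := by
      funext j
      exact congrArg x (by ring)
    rwa [e] at h
  | pred n ih =>
    rw [X.mem_iff_shift_mem]
    have e : leftShift A (fun j => x (j + (-(n : ℤ) - 1))) = fun j => x (j + (-(n : ℤ))) := by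
      funext j
      exact congrArg x (by ring)
    rwa [e]

theorem Subshift.IsStepSFT.exists_rel {X : Subshift A} (hX : X.IsStepSFT 1) :
    ∃ R : A → A → Prop, ∀ x, x ∈ X.carrier ↔ ∀ j : ℤ, R (x j) (x (j + 1)) := by
  obtain ⟨𝓕, h𝓕⟩ := hX
  refine ⟨fun a b => ![a, b] ∉ 𝓕, fun x => ?_⟩
  rw [h𝓕]
  refine forall_congr' fun j => ?_
  have e : (fun i : Fin (1 + 1) => x (j + ((i : ℕ) : ℤ))) = ![x j, x (j + 1)] := by
    funext i
    fin_cases i <;> simp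
  rw [e]

/-- The concatenation of the blocks `s q 0, …, s q (p - 1)`, `q ∈ ℤ`. -/
def concat {A : Type*} (p : ℤ) (s : ℤ → ℤ → A) : ℤ → A := fun j => s (j / p) (j % p)

theorem concat_apply {A : Type*} (p : ℤ) (s : ℤ → ℤ → A) (q r : ℤ) (h0 : 0 ≤ r) (h1 : r < p) :
    concat p s (q * p + r) = s q r := by
  have hp : p ≠ 0 := by omega
  have e1 : (q * p + r) / p = q := by
    rw [add_comm, Int.add_mul_ediv_right _ _ hp, Int.ediv_eq_zero_of_lt h0 h1, zero_add]
  have e2 : (q * p + r) % p = r := by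
    rw [add_comm, Int.add_mul_emod_self_right, Int.emod_eq_of_lt h0 h1]
  rw [concat, e1, e2]

/-- A 1-step constraint sees only adjacent letters. At a junction the letter that would follow block
`q` is the first letter of block `q + 1`, so every transition already occurs in some `s q`. -/
theorem Subshift.IsStepSFT.concat_mem {X : Subshift A} (hX : X.IsStepSFT 1) {p : ℤ} (hp : 0 < p)
    (s : ℤ → ℤ → A) (hs : ∀ q, s q ∈ X.carrier) (hq : ∀ q, s q p = s (q + 1) 0) :
    concat p s ∈ X.carrier := by
  obtain ⟨R, hR⟩ := hX.exists_rel
  rw [hR]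
  intro j
  have hj := Int.ediv_mul_add_emod j p
  have h0 := Int.emod_nonneg j hp.ne'
  have h1 := Int.emod_lt_of_pos j hp
  generalize j / p = q at hj
  generalize j % p = r at hj h0 h1
  subst hj
  have h := (hR _).1 (hs q) r
  rw [concat_apply p s q r h0 h1]
  rcases (show r + 1 < p ∨ r + 1 = p by omega) with h2 | h2
  · rwa [add_assoc, concat_apply p s q (r + 1) (by omega) h2]
  · have e : q * p + r + 1 = (q + 1) * p + 0 := by rw [← h2]; ring
    rw [e, concat_apply p s _ 0 le_rfl hp, ← hq, ← h2]
    exact h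

/-- The point that equals `w` on `[c, d]` and `x` elsewhere. -/
def splice {A : Type*} (c d : ℤ) (x w : ℤ → A) : ℤ → A := fun j => if c ≤ j ∧ j ≤ d then w j else x j

/-- Agreement at `c` and `d` makes the transitions entering and leaving the window transitions of
`x`. -/
theorem Subshift.IsStepSFT.splice_mem {X : Subshift A} (hX : X.IsStepSFT 1) {c d : ℤ}
    {x w : ℤ → A} (hx : x ∈ X.carrier) (hw : w ∈ X.carrier) (hc : w c = x c) (hd : w d = x d) :
    splice c d x w ∈ X.carrier := by
  obtain ⟨R, hR⟩ := hX.exists_rel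
  rw [hR] at hx hw ⊢
  intro j
  have h1 := hx j
  have h2 := hw j
  unfold splice
  by_cases hj : c ≤ j ∧ j ≤ d
  · by_cases hj' : c ≤ j + 1 ∧ j + 1 ≤ d
    · rwa [if_pos hj, if_pos hj']
    · obtain rfl : j = d := by omega
      rwa [if_pos hj, if_neg hj', hd]
  · by_cases hj' : c ≤ j + 1 ∧ j + 1 ≤ d
    · obtain rfl : j + 1 = c := by omega
      rwa [if_neg hj, if_pos hj', hc]
    · rwa [if_neg hj, if_neg hj']

/-- Two successive gluings; `b₁ ≤ b₂` ensures that the second leaves the first left half intact. -/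
theorem Subshift.IsTransitive.exists_glue {X : Subshift A} (hX : X.IsTransitive) :
    ∃ D : ℕ, ∀ x₁ ∈ X.carrier, ∀ x₂ ∈ X.carrier, ∀ x₃ ∈ X.carrier, ∀ b₁ a₂ b₂ a₃ : ℤ,
      b₁ ≤ b₂ → (D : ℤ) ≤ a₂ - b₁ → (D : ℤ) ≤ a₃ - b₂ →
      ∃ x ∈ X.carrier, (∀ j ≤ b₁, x j = x₁ j) ∧ (∀ j, a₂ ≤ j → j ≤ b₂ → x j = x₂ j) ∧
        ∀ j ≥ a₃, x j = x₃ j := by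
  obtain ⟨D, hD⟩ := hX
  refine ⟨D, fun x₁ h₁ x₂ h₂ x₃ h₃ b₁ a₂ b₂ a₃ hb h₁₂ h₂₃ => ?_⟩
  obtain ⟨x, hx, hx'⟩ := hD ⟨x₁, h₁⟩ ⟨x₂, h₂⟩ b₁ a₂ h₁₂
  obtain ⟨w, hw, hw'⟩ := hD x ⟨x₃, h₃⟩ b₂ a₃ h₂₃
  refine ⟨w.1, w.2, fun j hj => ?_, fun j hj hj' => ?_, hw'⟩
  · rw [hw j (hj.trans hb), hx j hj]
  · rw [hw j hj', hx' j hj]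

end Words

/-! ### Minimal cost over a block -/

section Cost

variable {A : Type*} [TopologicalSpace A]

/-- The minimum of `∑ F (x i) (w i)` over the points `x` of `X`. -/
def wordMin (X : Subshift A) (F : A → A → ℝ) {n : ℕ} (w : Fin n → A) : ℝ :=
  ⨅ x : X, ∑ i : Fin n, F (x.1 ((i : ℕ) : ℤ)) (w i)

/-- The minimum of `∑ j < n, F (x j) (y j)` over the points `x` of `X`. -/
def blockMin (X : Subshift A) (F : A → A → ℝ) (n : ℕ) (y : ℤ → A) : ℝ :=
  wordMin X F fun i : Fin n => y ((i : ℕ) : ℤ)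

theorem exists_abs_le {A : Type*} [Finite A] (F : A → A → ℝ) : ∃ B : ℝ, 0 ≤ B ∧ ∀ a b, |F a b| ≤ B := by
  obtain ⟨M, hM⟩ := (Set.finite_range fun q : A × A => |F q.1 q.2|).bddAbove
  exact ⟨max M 0, le_max_right _ _, fun a b => (hM ⟨(a, b), rfl⟩).trans (le_max_left _ _)⟩

theorem abs_sum_cost_le {A : Type*} {F : A → A → ℝ} {B : ℝ} (hB : ∀ a b, |F a b| ≤ B) {ι : Type*}
    (s : Finset ι) (u v : ι → A) : |∑ i ∈ s, F (u i) (v i)| ≤ s.card * B := by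
  refine (Finset.abs_sum_le_sum_abs _ _).trans ?_
  have := Finset.sum_le_card_nsmul s (fun i => |F (u i) (v i)|) B fun i _ => hB _ _
  simpa using this

variable [Finite A]

theorem exists_eq_wordMin (X : Subshift A) (F : A → A → ℝ) {n : ℕ} (w : Fin n → A) :
    ∃ x ∈ X.carrier, ∑ i : Fin n, F (x ((i : ℕ) : ℤ)) (w i) = wordMin X F w := by
  have : Nonempty X := X.nonempty.to_subtype
  have hfin : (Set.range fun x : X => ∑ i : Fin n, F (x.1 ((i : ℕ) : ℤ)) (w i)).Finite := by
    refine (Set.finite_range fun u : Fin n → A => ∑ i, F (u i) (w i)).subset ?_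
    rintro _ ⟨x, rfl⟩
    exact ⟨fun i => x.1 ((i : ℕ) : ℤ), rfl⟩
  obtain ⟨x, hx⟩ := (Set.range_nonempty _).csInf_mem hfin
  exact ⟨x.1, x.2, hx⟩

theorem wordMin_le (X : Subshift A) (F : A → A → ℝ) {n : ℕ} (w : Fin n → A) {x : ℤ → A}
    (hx : x ∈ X.carrier) : wordMin X F w ≤ ∑ i : Fin n, F (x ((i : ℕ) : ℤ)) (w i) := by
  obtain ⟨B, -, hB⟩ := exists_abs_le F
  refine ciInf_le (f := fun x : X => ∑ i : Fin n, F (x.1 ((i : ℕ) : ℤ)) (w i))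
    ⟨-((Finset.univ : Finset (Fin n)).card * B), ?_⟩ (⟨x, hx⟩ : X)
  rintro _ ⟨u, rfl⟩
  exact (abs_le.1 (abs_sum_cost_le hB _ (fun i : Fin n => u.1 ((i : ℕ) : ℤ)) w)).1

theorem exists_eq_blockMin (X : Subshift A) (F : A → A → ℝ) (n : ℕ) (y : ℤ → A) :
    ∃ x ∈ X.carrier, ∑ j ∈ Finset.range n, F (x j) (y j) = blockMin X F n y := by
  obtain ⟨x, hx, h⟩ := exists_eq_wordMin X F fun i : Fin n => y ((i : ℕ) : ℤ)
  exact ⟨x, hx, by rw [blockMin, ← h, Fin.sum_univ_eq_sum_range (fun j => F (x j) (y j))]⟩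

theorem blockMin_le (X : Subshift A) (F : A → A → ℝ) (n : ℕ) (y : ℤ → A) {x : ℤ → A}
    (hx : x ∈ X.carrier) : blockMin X F n y ≤ ∑ j ∈ Finset.range n, F (x j) (y j) := by
  rw [← Fin.sum_univ_eq_sum_range (fun j => F (x j) (y j))]
  exact wordMin_le X F _ hx

theorem abs_blockMin_le (X : Subshift A) {F : A → A → ℝ} {B : ℝ} (hB : ∀ a b, |F a b| ≤ B)
    (n : ℕ) (y : ℤ → A) : |blockMin X F n y| ≤ n * B := by
  obtain ⟨x, -, h⟩ := exists_eq_blockMin X F n y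
  rw [← h]
  simpa using abs_sum_cost_le hB (Finset.range n) (fun j => x j) (fun j => y j)

/-- Shifting an optimal `x` together with `y` changes the sum only by one term at each end. -/
theorem abs_blockMin_shift_sub_le (X : Subshift A) {F : A → A → ℝ} {B : ℝ}
    (hB : ∀ a b, |F a b| ≤ B) (n : ℕ) (y : ℤ → A) :
    |blockMin X F n (fun j => y (j + 1)) - blockMin X F n y| ≤ 2 * B := by
  have key : ∀ x : ℤ → A, |∑ j ∈ Finset.range n, F (x (j + 1)) (y (j + 1)) -
      ∑ j ∈ Finset.range n, F (x j) (y j)| ≤ 2 * B := by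
    intro x
    have h := Finset.sum_range_sub (fun j : ℕ => F (x j) (y j)) n
    rw [Finset.sum_sub_distrib] at h
    push_cast at h
    rw [h]
    refine (abs_sub _ _).trans ?_
    linarith [hB (x n) (y n), hB (x 0) (y 0)]
  rw [abs_sub_le_iff]
  constructor
  · obtain ⟨x, hx, h⟩ := exists_eq_blockMin X F n y
    have h1 := blockMin_le X F n (fun j => y (j + 1)) (X.translate_mem hx 1)
    have h2 := (abs_le.1 (key x)).2
    linarith
  · obtain ⟨x, hx, h⟩ := exists_eq_blockMin X F n (fun j => y (j + 1))
    have h1 := blockMin_le X F n y (X.translate_mem hx (-1))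
    have h2 := (abs_le.1 (key fun j => x (j + -1))).1
    simp only [add_neg_cancel_right] at h2
    linarith

theorem abs_blockMin_translate_sub_le (X : Subshift A) {F : A → A → ℝ} {B : ℝ}
    (hB : ∀ a b, |F a b| ≤ B) (n : ℕ) (y : ℤ → A) (i : ℕ) :
    |blockMin X F n (fun j => y (j + i)) - blockMin X F n y| ≤ 2 * B * i := by
  induction i with
  | zero => simp
  | succ i ih =>
    have h := abs_blockMin_shift_sub_le X hB n (fun j => y (j + i))
    have e : (fun j : ℤ => y (j + 1 + i)) = fun j => y (j + ((i + 1 : ℕ) : ℤ)) := by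
      funext j
      exact congrArg y (by push_cast; ring)
    rw [e] at h
    refine (abs_sub_le _ _ _).trans ((add_le_add h ih).trans ?_)
    push_cast
    linarith

theorem abs_blockMin_translate_int_sub_le (X : Subshift A) {F : A → A → ℝ} {B : ℝ}
    (hB : ∀ a b, |F a b| ≤ B) (n : ℕ) (y : ℤ → A) (i : ℤ) :
    |blockMin X F n (fun j => y (j + i)) - blockMin X F n y| ≤ 2 * B * |i| := by
  obtain ⟨k, rfl | rfl⟩ := Int.eq_nat_or_neg i
  · simpa using abs_blockMin_translate_sub_le X hB n y k
  · have h := abs_blockMin_translate_sub_le X hB n (fun j => y (j + -(k : ℤ))) k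
    simp only [add_neg_cancel_right] at h
    rw [abs_sub_comm] at h
    simpa using h

theorem sum_range_mul_eq {M : Type*} [AddCommMonoid M] (g : ℕ → M) (L p : ℕ) :
    ∑ j ∈ Finset.range (L * p), g j =
      ∑ q ∈ Finset.range L, ∑ r ∈ Finset.range p, g (q * p + r) := by
  induction L with
  | zero => simp
  | succ L ih => rw [Nat.succ_mul, Finset.sum_range_add, ih, Finset.sum_range_succ]

/-- If on every block of length `p` any point `x` of `X` can be changed, with fixed end letters,
so that its cost against `u` is lower by `δ` than the cost of `x` against `t`, then the same holds,
with the gain added up, for the periodic points with period words `u` and `t`. -/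
theorem blockMin_add_le_of_block {X : Subshift A} (hX : X.IsStepSFT 1) {F : A → A → ℝ} {p : ℕ}
    (hp : 0 < p) {u t : ℤ → A} {δ : ℝ}
    (h : ∀ x ∈ X.carrier, ∃ x' ∈ X.carrier, x' 0 = x 0 ∧ x' p = x p ∧
      ∑ j ∈ Finset.range p, F (x' j) (u j) + δ ≤ ∑ j ∈ Finset.range p, F (x j) (t j)) (L : ℕ) :
    blockMin X F (L * p) (concat p fun _ => u) + L * δ ≤
      blockMin X F (L * p) (concat p fun _ => t) := by
  obtain ⟨x, hx, hmin⟩ := exists_eq_blockMin X F (L * p) (concat p fun _ => t)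
  choose! g hgX hg0 hgp hg using h
  have hmem : ∀ q : ℤ, (fun j => x (j + q * p)) ∈ X.carrier := fun q => X.translate_mem hx _
  -- The block changes keep both end letters, so consecutive changed blocks still match where they
  -- meet.
  have hc : concat p (fun q => g fun j => x (j + q * p)) ∈ X.carrier := by
    refine hX.concat_mem (by exact_mod_cast hp) _ (fun q => hgX _ (hmem q)) fun q => ?_
    rw [hgp _ (hmem q), hg0 _ (hmem (q + 1))]
    exact congrArg x (by ring)
  have h1 := blockMin_le X F (L * p) (concat p fun _ => u) hc
  rw [← hmin]
  refine (add_le_add_left h1 _).trans ?_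
  rw [sum_range_mul_eq, sum_range_mul_eq]
  have e : (L : ℝ) * δ = ∑ q ∈ Finset.range L, δ := by simp
  rw [e, ← Finset.sum_add_distrib]
  refine Finset.sum_le_sum fun q _ => ?_
  have h2 := hg _ (hmem q)
  have e1 : ∀ (s : ℤ → ℤ → A), ∀ r ∈ Finset.range p,
      concat p s ((q * p + r : ℕ) : ℤ) = s q r := by
    intro s r hr
    push_cast
    exact concat_apply _ _ _ _ (by positivity) (by exact_mod_cast Finset.mem_range.1 hr)
  refine le_trans (le_of_eq ?_) (h2.trans (le_of_eq ?_))
  · congr 1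
    refine Finset.sum_congr rfl fun r hr => ?_
    rw [e1 _ r hr, e1 _ r hr]
  · refine Finset.sum_congr rfl fun r hr => ?_
    rw [e1 _ r hr]
    congr 2
    push_cast
    ring

end Cost

/-! ### Averages of measures -/

section Averages

variable {Z : Type*} [TopologicalSpace Z] [MeasurableSpace Z]

theorem averageMeasure_mem_invariantMeasures {U : Z ≃ₜ Z} (hU : Measurable U) {k : ℕ}
    (hk : 0 < k) {μ : Measure Z} [IsProbabilityMeasure μ] (hμ : μ.map U^[k] = μ) :
    averageMeasure U k μ ∈ invariantMeasures U := by
  refine ⟨⟨?_⟩, hU, ?_⟩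
  · have h : ∀ j ∈ Finset.range k, μ.map U^[j] Set.univ = 1 := fun j _ => by
      rw [Measure.map_apply (hU.iterate j) MeasurableSet.univ]
      simp
    rw [averageMeasure, Measure.smul_apply, Measure.finsetSum_apply, Finset.sum_congr rfl h]
    simp only [Finset.sum_const, Finset.card_range, nsmul_eq_mul, mul_one, smul_eq_mul]
    exact ENNReal.inv_mul_cancel (by exact_mod_cast hk.ne') (ENNReal.natCast_ne_top k)
  · have h : ∀ j ∈ Finset.range k, (μ.map U^[j]).map U = μ.map U^[j + 1] := fun j _ => by
      rw [Measure.map_map hU (hU.iterate j), Function.iterate_succ']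
    rw [averageMeasure, Measure.map_smul, Measure.map_finset_sum hU.aemeasurable,
      Finset.sum_congr rfl h]
    -- Pushing forward by `U` shifts the index by one; `hμ` identifies the new last term with the
    -- lost first one.
    obtain ⟨m, rfl⟩ := Nat.exists_eq_succ_of_ne_zero hk.ne'
    rw [Finset.sum_range_succ, Finset.sum_range_succ' (fun j => μ.map U^[j]), hμ]
    simp

theorem map_averageMeasure {Y : Type*} [TopologicalSpace Y] [MeasurableSpace Y] {U : Z ≃ₜ Z}
    (hU : Measurable U) {S : Y ≃ₜ Y} {π : Z → Y} (hπ : Measurable π)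
    (hsemi : Function.Semiconj π U S) {k : ℕ} (hk : 0 < k) {μ : Measure Z}
    (hμ : MeasurePreserving S (μ.map π) (μ.map π)) :
    (averageMeasure U k μ).map π = μ.map π := by
  have h : ∀ j ∈ Finset.range k, (μ.map U^[j]).map π = μ.map π := fun j _ => by
    rw [Measure.map_map hπ (hU.iterate j), (hsemi.iterate_right j).comp_eq,
      ← Measure.map_map (hμ.measurable.iterate j) hπ, (hμ.iterate j).map_eq]
  rw [averageMeasure, Measure.map_smul, Measure.map_finset_sum hπ.aemeasurable,
    Finset.sum_congr rfl h, Finset.sum_const, Finset.card_range, ← Nat.cast_smul_eq_nsmul ENNReal,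
    smul_smul, ENNReal.inv_mul_cancel (by exact_mod_cast hk.ne') (ENNReal.natCast_ne_top k),
    one_smul]

theorem integral_averageMeasure {U : Z ≃ₜ Z} (hU : Measurable U) (k : ℕ) {μ : Measure Z}
    [IsProbabilityMeasure μ] {g : Z → ℝ} (hg : Measurable g) {B : ℝ} (hB : ∀ z, |g z| ≤ B) :
    k * ∫ z, g z ∂averageMeasure U k μ = ∫ z, ∑ j ∈ Finset.range k, g (U^[j] z) ∂μ := by
  have hb : ∀ (ρ : Measure Z) [IsFiniteMeasure ρ], Integrable g ρ := fun ρ _ =>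
    Integrable.of_bound hg.aestronglyMeasurable B (Filter.Eventually.of_forall hB)
  rcases Nat.eq_zero_or_pos k with rfl | hk
  · simp
  have hi : ∀ j ∈ Finset.range k, ∫ z, g z ∂μ.map U^[j] = ∫ z, g (U^[j] z) ∂μ := fun j _ =>
    integral_map (hU.iterate j).aemeasurable hg.aestronglyMeasurable
  have hi' : ∀ j ∈ Finset.range k, Integrable (fun z => g (U^[j] z)) μ := fun j _ =>
    Integrable.of_bound (hg.comp (hU.iterate j)).aestronglyMeasurable B
      (Filter.Eventually.of_forall fun z => hB _)
  rw [averageMeasure, integral_smul_measure, integral_finsetSum_measure fun j _ => ?_,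
    Finset.sum_congr rfl hi, integral_finsetSum _ hi']
  · have : (k : ℝ) ≠ 0 := by exact_mod_cast hk.ne'
    simp [this]
  · have := Measure.isProbabilityMeasure_map (μ := μ) (hU.iterate j).aemeasurable
    exact hb _

end Averages

/-! ### The shift dynamics in coordinates -/

section Coordinates

variable {A : Type*} [TopologicalSpace A]

theorem Subshift.shift_apply (X : Subshift A) (x : X) (j : ℤ) :
    (X.shift x).1 j = x.1 (j + 1) := rfl

theorem Subshift.shift_iterate_apply (X : Subshift A) (x : X) (n : ℕ) (j : ℤ) :
    (X.shift^[n] x).1 j = x.1 (j + n) := by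
  induction n generalizing j with
  | zero => simp
  | succ n ih =>
    rw [Function.iterate_succ_apply', X.shift_apply, ih]
    exact congrArg x.1 (by push_cast; ring)

theorem Subshift.shift_zpow_apply (X : Subshift A) (x : X) (n : ℤ) (j : ℤ) :
    ((X.shift ^ n) x).1 j = x.1 (j + n) := by
  induction n using Int.induction_on generalizing j with
  | zero => simp
  | succ n ih =>
    have e : (X.shift ^ ((n : ℤ) + 1)) x = X.shift ((X.shift ^ (n : ℤ)) x) := by
      rw [add_comm, zpow_one_add]
      rfl
    rw [e, X.shift_apply, ih]
    exact congrArg x.1 (by ring)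
  | pred n ih =>
    have e : X.shift ((X.shift ^ (-(n : ℤ) - 1)) x) = (X.shift ^ (-(n : ℤ))) x := by
      have : X.shift ^ (-(n : ℤ)) = X.shift * X.shift ^ (-(n : ℤ) - 1) := by
        rw [← zpow_one_add]
        congr 1
        ring
      rw [this]
      rfl
    have h := ih (j - 1)
    rw [← e, X.shift_apply, sub_add_cancel] at h
    rw [h]
    exact congrArg x.1 (by ring)

theorem Subshift.isPeriodicPt_shift_iff (X : Subshift A) (x : X) (k : ℕ) :
    Function.IsPeriodicPt X.shift k x ↔ ∀ j, x.1 (j + k) = x.1 j := by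
  rw [Function.IsPeriodicPt, Function.IsFixedPt, Subtype.ext_iff, funext_iff]
  simp only [X.shift_iterate_apply]

theorem prodCongr_shift_iterate (X Y : Subshift A) (n : ℕ) (x : X) (y : Y) :
    (X.shift.prodCongr Y.shift)^[n] (x, y) = (X.shift^[n] x, Y.shift^[n] y) := by
  rw [Homeomorph.coe_prodCongr, Prod.map_iterate, Prod.map_apply]

theorem prodCongr_shift_zpow (X Y : Subshift A) (n : ℤ) (x : X) (y : Y) :
    (X.shift.prodCongr Y.shift ^ n) (x, y) = ((X.shift ^ n) x, (Y.shift ^ n) y) := by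
  have h : X.shift.prodCongr Y.shift ^ n = (X.shift ^ n).prodCongr (Y.shift ^ n) := by
    let φ : (X ≃ₜ X) × (Y ≃ₜ Y) →* (↥X × ↥Y ≃ₜ ↥X × ↥Y) :=
      { toFun := fun e => e.1.prodCongr e.2
        map_one' := by ext <;> rfl
        map_mul' := fun a b => by ext <;> rfl }
    exact (map_zpow φ (X.shift, Y.shift) n).symm
  rw [h]
  rfl

variable {X Y : Subshift A} {f : C(X × Y, ℝ)} {F : A → A → ℝ}

theorem orbitSum_eq (hf : ∀ (x : X) (y : Y), f (x, y) = F (x.1 0) (y.1 0)) (a b : ℤ) (x : X)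
    (y : Y) : orbitSum (X.shift.prodCongr Y.shift) f a b (x, y) =
      ∑ j ∈ Finset.Icc a b, F (x.1 j) (y.1 j) := by
  refine Finset.sum_congr rfl fun j _ => ?_
  rw [prodCongr_shift_zpow, hf, X.shift_zpow_apply, Y.shift_zpow_apply, zero_add]

theorem sum_iterate_eq (hf : ∀ (x : X) (y : Y), f (x, y) = F (x.1 0) (y.1 0)) (n : ℕ) (x : X)
    (y : Y) : ∑ j ∈ Finset.range n, f ((X.shift.prodCongr Y.shift)^[j] (x, y)) =
      ∑ j ∈ Finset.range n, F (x.1 j) (y.1 j) := by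
  refine Finset.sum_congr rfl fun j _ => ?_
  rw [prodCongr_shift_iterate, hf, X.shift_iterate_apply, Y.shift_iterate_apply, zero_add]

theorem minSum_le [Finite A] (hf : ∀ (x : X) (y : Y), f (x, y) = F (x.1 0) (y.1 0)) (a b : ℤ)
    (y : Y) (x : X) :
    minSum X Y f a b (x.1 a, x.1 b) y ≤ ∑ j ∈ Finset.Icc a b, F (x.1 j) (y.1 j) := by
  obtain ⟨B, -, hB⟩ := exists_abs_le F
  refine csInf_le ⟨-((Finset.Icc a b).card * B), ?_⟩ ⟨x, ⟨rfl, rfl⟩, orbitSum_eq hf a b x y⟩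
  rintro _ ⟨u, -, rfl⟩
  simp only [orbitSum_eq hf]
  exact (abs_le.1 (abs_sum_cost_le hB _ (fun i : ℤ => u.1 i) y.1)).1

/-- The end letters may be ignored for a lower bound; `hv` is needed because `sInf ∅ = 0`. -/
theorem le_minSum (hf : ∀ (x : X) (y : Y), f (x, y) = F (x.1 0) (y.1 0)) {a b : ℤ} {y : Y}
    {v : A × A} (hv : v ∈ endpointPairs X a b) {c : ℝ}
    (h : ∀ x : X, c ≤ ∑ j ∈ Finset.Icc a b, F (x.1 j) (y.1 j)) : c ≤ minSum X Y f a b v y := by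
  obtain ⟨x, hx⟩ := hv
  refine le_csInf ⟨_, x, hx, rfl⟩ ?_
  rintro _ ⟨u, -, rfl⟩
  simp only [orbitSum_eq hf]
  exact h u

theorem exists_sum_lt_of_minSum_lt (hf : ∀ (x : X) (y : Y), f (x, y) = F (x.1 0) (y.1 0))
    {a b : ℤ} {y : Y} {v : A × A} (hv : v ∈ endpointPairs X a b) {c : ℝ}
    (h : minSum X Y f a b v y < c) :
    ∃ x : X, x.1 a = v.1 ∧ x.1 b = v.2 ∧ ∑ j ∈ Finset.Icc a b, F (x.1 j) (y.1 j) < c := by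
  obtain ⟨x, hx⟩ := hv
  unfold minSum at h
  obtain ⟨_, ⟨u, hu, rfl⟩, hlt⟩ := exists_lt_of_csInf_lt (Set.Nonempty.image _ ⟨x, hx⟩) h
  simp only [orbitSum_eq hf] at hlt
  exact ⟨u, hu.1, hu.2, hlt⟩

end Coordinates

/-! ### Bounds for `psi` by block minima -/

section Bounds

variable {A : Type*} [Finite A] [TopologicalSpace A] [DiscreteTopology A] [MeasurableSpace A]
  [BorelSpace A] {X Y : Subshift A} {f : C(X × Y, ℝ)} {F : A → A → ℝ}

omit [Finite A] [DiscreteTopology A] [BorelSpace A] in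
theorem Subshift.measurable_coord (X : Subshift A) (j : ℤ) : Measurable fun x : X => x.1 j :=
  (measurable_pi_apply j).comp measurable_subtype_coe

omit [Finite A] [DiscreteTopology A] [BorelSpace A] in
theorem Subshift.measurable_shift (X : Subshift A) : Measurable X.shift :=
  Measurable.subtype_mk (measurable_pi_iff.2 fun j => X.measurable_coord (j + 1))

omit [Finite A] [DiscreteTopology A] [BorelSpace A] in
theorem measurable_prodCongr_shift (X Y : Subshift A) :
    Measurable (X.shift.prodCongr Y.shift) :=
  X.measurable_shift.prodMap Y.measurable_shift

/-- Such a function factors through the finite discrete space of words. -/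
theorem measurable_of_window {α : Type*} [MeasurableSpace α] (Y : Subshift A) {n : ℕ} (a : ℤ)
    (g : (Fin n → A) → α) :
    Measurable fun y : Y => g fun i : Fin n => y.1 (a + ((i : ℕ) : ℤ)) :=
  (Measurable.of_discrete (f := g)).comp (measurable_pi_iff.2 fun _ => Y.measurable_coord _)

theorem measurable_blockMin (X Y : Subshift A) (F : A → A → ℝ) (n : ℕ) :
    Measurable fun y : Y => blockMin X F n y.1 := by
  simpa [blockMin] using measurable_of_window Y 0 (wordMin X F (n := n))

theorem measurable_cost (hf : ∀ (x : X) (y : Y), f (x, y) = F (x.1 0) (y.1 0)) :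
    Measurable f := by
  have h : (f : X × Y → ℝ) = fun z => Function.uncurry F (z.1.1 0, z.2.1 0) :=
    funext fun z => hf z.1 z.2
  rw [h]
  exact (Measurable.of_discrete (f := Function.uncurry F)).comp
    (((X.measurable_coord 0).comp measurable_fst).prodMk
      ((Y.measurable_coord 0).comp measurable_snd))

theorem integrable_blockMin (X Y : Subshift A) (F : A → A → ℝ) (n : ℕ) (ν : Measure Y)
    [IsProbabilityMeasure ν] : Integrable (fun y : Y => blockMin X F n y.1) ν := by
  obtain ⟨B, -, hB⟩ := exists_abs_le F
  exact Integrable.of_bound (measurable_blockMin X Y F n).aestronglyMeasurable (n * B)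
    (Filter.Eventually.of_forall fun y => abs_blockMin_le X hB n y.1)

/-- Invariance turns `n ∫ f` into the integral of an orbit sum, which dominates `blockMin`
pointwise. -/
theorem integral_blockMin_le (hf : ∀ (x : X) (y : Y), f (x, y) = F (x.1 0) (y.1 0))
    {μ : Measure (X × Y)} (hμ : μ ∈ invariantMeasures (X.shift.prodCongr Y.shift)) (n : ℕ) :
    ∫ y : Y, blockMin X F n y.1 ∂μ.map Prod.snd ≤ n * ∫ z, f z ∂μ := by
  obtain ⟨hprob, hpres⟩ := hμ
  obtain ⟨B, -, hB⟩ := exists_abs_le F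
  have hfB : ∀ z, |f z| ≤ B := fun z => by
    rw [show f z = F (z.1.1 0) (z.2.1 0) from hf z.1 z.2]
    exact hB _ _
  have hfm := measurable_cost hf
  have hint : ∀ j : ℕ, Integrable (fun z => f ((X.shift.prodCongr Y.shift)^[j] z)) μ := fun j =>
    Integrable.of_bound (hfm.comp (hpres.measurable.iterate j)).aestronglyMeasurable B
      (Filter.Eventually.of_forall fun z => hfB _)
  have hsum : n * ∫ z, f z ∂μ =
      ∫ z, ∑ j ∈ Finset.range n, f ((X.shift.prodCongr Y.shift)^[j] z) ∂μ := by
    rw [integral_finsetSum _ fun j _ => hint j]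
    have h : ∀ j ∈ Finset.range n, ∫ z, f ((X.shift.prodCongr Y.shift)^[j] z) ∂μ =
        ∫ z, f z ∂μ := fun j _ => by
      rw [← integral_map (hpres.measurable.iterate j).aemeasurable hfm.aestronglyMeasurable,
        (hpres.iterate j).map_eq]
    rw [Finset.sum_congr rfl h]
    simp
  rw [hsum, integral_map measurable_snd.aemeasurable
    (measurable_blockMin X Y F n).aestronglyMeasurable]
  have := Measure.isProbabilityMeasure_map (μ := μ) measurable_snd.aemeasurable
  refine integral_mono ((integrable_blockMin X Y F n _).comp_measurable measurable_snd)
    (integrable_finsetSum _ fun j _ => hint j) fun z => ?_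
  simp only
  rw [show z = (z.1, z.2) from rfl, sum_iterate_eq hf]
  exact blockMin_le X F n _ z.1.2

/-- Code `y` blockwise by a point of `X` that is optimal on the middle `n` positions of each block
of length `n + 2 * D`; the `D` positions on either side serve for gluing and cost at most `2 * D *
B` in all. The coding commutes only with the `N`-th power of the shift, so the graph measure is
averaged over `N` steps. -/
theorem exists_joining_integral_le (hX : X.IsStepSFT 1) {D : ℕ}
    (hD : ∀ x₁ ∈ X.carrier, ∀ x₂ ∈ X.carrier, ∀ x₃ ∈ X.carrier, ∀ b₁ a₂ b₂ a₃ : ℤ,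
      b₁ ≤ b₂ → (D : ℤ) ≤ a₂ - b₁ → (D : ℤ) ≤ a₃ - b₂ →
      ∃ x ∈ X.carrier, (∀ j ≤ b₁, x j = x₁ j) ∧ (∀ j, a₂ ≤ j → j ≤ b₂ → x j = x₂ j) ∧
        ∀ j ≥ a₃, x j = x₃ j)
    (hf : ∀ (x : X) (y : Y), f (x, y) = F (x.1 0) (y.1 0)) {B : ℝ} (hB : ∀ a b, |F a b| ≤ B)
    {ν : Measure Y} (hν : ν ∈ invariantMeasures Y.shift) {n : ℕ} (hn : 0 < n) :
    ∃ μ ∈ invariantMeasures (X.shift.prodCongr Y.shift), μ.map Prod.snd = ν ∧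
      ((n + 2 * D : ℕ) : ℝ) * ∫ z, f z ∂μ ≤
        ∫ y : Y, blockMin X F n y.1 ∂ν + 2 * D * B := by
  obtain ⟨hprob, hpres⟩ := hν
  obtain ⟨c, hc⟩ := X.nonempty
  set N : ℕ := n + 2 * D with hN
  have hNpos : 0 < N := by omega
  -- All blocks share the end letter `c 0`, so they can be concatenated in any order.
  have block : ∀ w : Fin n → A, ∃ ξ ∈ X.carrier, ξ 0 = c 0 ∧ ξ N = c 0 ∧
      ∑ i : Fin n, F (ξ (D + ((i : ℕ) : ℤ))) (w i) = wordMin X F w := by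
    intro w
    obtain ⟨x, hx, hmin⟩ := exists_eq_wordMin X F w
    obtain ⟨ξ, hξ, h1, h2, h3⟩ := hD c hc _ (X.translate_mem hx (-D)) _
      (X.translate_mem hc (-N)) 0 D (D + n - 1) N (by omega) (by omega) (by push_cast [hN]; omega)
    refine ⟨ξ, hξ, h1 0 le_rfl, by rw [h3 N le_rfl]; simp, ?_⟩
    rw [← hmin]
    refine Finset.sum_congr rfl fun i _ => ?_
    rw [h2 _ (by omega) (by have := i.2; omega)]
    congr 2
    ring
  choose ξ hξX hξ0 hξN hξ using block
  let win : Y → ℤ → Fin n → A := fun y q i => y.1 (q * N + D + ((i : ℕ) : ℤ))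
  let Φ : Y → X := fun y => ⟨concat N fun q => ξ (win y q),
    hX.concat_mem (by exact_mod_cast hNpos) _ (fun q => hξX _) fun q => by rw [hξN, hξ0]⟩
  have hΦm : Measurable Φ := by
    refine Measurable.subtype_mk (measurable_pi_iff.2 fun j => ?_)
    exact measurable_of_window Y (j / N * N + D) fun w => ξ w (j % N)
  have hΦ : ∀ y, Φ (Y.shift^[N] y) = X.shift^[N] (Φ y) := by
    intro y
    ext j
    rw [X.shift_iterate_apply]
    simp only [Φ, concat, win, Y.shift_iterate_apply]
    rw [Int.add_emod_right, Int.add_ediv_of_dvd_right (dvd_refl _),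
      Int.ediv_self (by exact_mod_cast hNpos.ne')]
    congr 1
    funext i
    exact congrArg y.1 (by ring)
  have hgm : Measurable fun y : Y => (Φ y, y) := hΦm.prodMk measurable_id
  have hUm := measurable_prodCongr_shift X Y
  have hprob' : IsProbabilityMeasure (ν.map fun y : Y => (Φ y, y)) :=
    Measure.isProbabilityMeasure_map hgm.aemeasurable
  have hsnd : (ν.map fun y : Y => (Φ y, y)).map Prod.snd = ν := by
    rw [Measure.map_map measurable_snd hgm]
    exact Measure.map_id
  have hper : (ν.map fun y : Y => (Φ y, y)).map (X.shift.prodCongr Y.shift)^[N] =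
      ν.map fun y : Y => (Φ y, y) := by
    rw [Measure.map_map (hUm.iterate N) hgm]
    conv_rhs => rw [← (hpres.iterate N).map_eq]
    rw [Measure.map_map hgm (hpres.measurable.iterate N)]
    congr 1
    funext y
    simp only [Function.comp_apply]
    rw [prodCongr_shift_iterate, hΦ]
  have hfm := measurable_cost hf
  have hfB : ∀ z, |f z| ≤ B := fun z => by
    rw [show f z = F (z.1.1 0) (z.2.1 0) from hf z.1 z.2]
    exact hB _ _
  refine ⟨averageMeasure (X.shift.prodCongr Y.shift) N (ν.map fun y : Y => (Φ y, y)),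
    averageMeasure_mem_invariantMeasures hUm hNpos hper, ?_, ?_⟩
  · rw [map_averageMeasure (S := Y.shift) hUm measurable_snd (fun z => rfl) hNpos
      (by rw [hsnd]; exact hpres), hsnd]
  · have hsm : Measurable fun z : X × Y =>
        ∑ j ∈ Finset.range N, f ((X.shift.prodCongr Y.shift)^[j] z) :=
      Finset.measurable_fun_sum _ fun j _ => hfm.comp (hUm.iterate j)
    rw [integral_averageMeasure hUm N hfm hfB, integral_map hgm.aemeasurable
      hsm.aestronglyMeasurable]
    -- The optimized window starts at `D`, not at `0`; invariance of `ν` absorbs the shift.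
    have hshift : ∫ y : Y, blockMin X F n y.1 ∂ν =
        ∫ y : Y, blockMin X F n (Y.shift^[D] y).1 ∂ν := by
      rw [← integral_map (φ := Y.shift^[D]) (f := fun y : Y => blockMin X F n y.1)
        (hpres.measurable.iterate D).aemeasurable
        (measurable_blockMin X Y F n).aestronglyMeasurable, (hpres.iterate D).map_eq]
    have hint : Integrable (fun y : Y => blockMin X F n (Y.shift^[D] y).1) ν :=
      (hpres.iterate D).integrable_comp_of_integrable (integrable_blockMin X Y F n ν)
    have hconst : (2 * D * B : ℝ) = ∫ _ : Y, (2 * D * B : ℝ) ∂ν := by simp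
    rw [hshift, hconst, ← integral_add hint (integrable_const _)]
    refine integral_mono (Integrable.of_bound (hsm.comp hgm).aestronglyMeasurable (N * B)
      (Filter.Eventually.of_forall fun y => ?_)) (hint.add (integrable_const _)) fun y => ?_
    · rw [sum_iterate_eq hf]
      simpa using abs_sum_cost_le hB (Finset.range N) (fun j => (Φ y).1 j) (fun j => y.1 j)
    · simp only
      rw [sum_iterate_eq hf]
      have hΦy : ∀ j ∈ Finset.range N, F ((Φ y).1 j) (y.1 j) = F (ξ (win y 0) j) (y.1 j) := by
        intro j hj
        have h := concat_apply (N : ℤ) (fun q => ξ (win y q)) 0 j (by omega)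
          (by exact_mod_cast Finset.mem_range.1 hj)
        rw [zero_mul, zero_add] at h
        rw [← h]
      rw [Finset.sum_congr rfl hΦy, show N = D + n + D by omega, Finset.sum_range_add,
        Finset.sum_range_add]
      have hmid : ∑ i ∈ Finset.range n, F (ξ (win y 0) ((D + i : ℕ) : ℤ)) (y.1 ((D + i : ℕ) : ℤ)) =
          blockMin X F n (Y.shift^[D] y).1 := by
        have e : (fun i : Fin n => (Y.shift^[D] y).1 ((i : ℕ) : ℤ)) = win y 0 := by
          funext i
          rw [Y.shift_iterate_apply]
          exact congrArg y.1 (by ring)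
        rw [blockMin, e, ← hξ (win y 0), ← Fin.sum_univ_eq_sum_range
          (fun i => F (ξ (win y 0) ((D + i : ℕ) : ℤ)) (y.1 ((D + i : ℕ) : ℤ)))]
        refine Finset.sum_congr rfl fun i _ => ?_
        simp [win]
      rw [hmid]
      have h1 := (abs_le.1 (abs_sum_cost_le hB (Finset.range D)
        (fun j => ξ (win y 0) j) (fun j => y.1 j))).2
      have h2 := (abs_le.1 (abs_sum_cost_le hB (Finset.range D)
        (fun j => ξ (win y 0) ((D + n + j : ℕ) : ℤ)) (fun j => y.1 ((D + n + j : ℕ) : ℤ)))).2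
      rw [Finset.card_range] at h1 h2
      linarith

/-- Up to an additive constant, `n ψ_f(ν)` is the integral of the minimal cost over blocks of
length `n`. -/
theorem exists_abs_mul_psi_sub_le (hX : X.IsStepSFT 1) (hXt : X.IsTransitive)
    (hf : ∀ (x : X) (y : Y), f (x, y) = F (x.1 0) (y.1 0)) :
    ∃ K : ℝ, 0 ≤ K ∧ ∀ ν ∈ invariantMeasures Y.shift, ∀ n : ℕ, 0 < n →
      ∫ y : Y, blockMin X F n y.1 ∂ν ≤
        n * psi (X.shift.prodCongr Y.shift) Prod.snd f ν ∧
      n * psi (X.shift.prodCongr Y.shift) Prod.snd f ν ≤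
        ∫ y : Y, blockMin X F n y.1 ∂ν + K := by
  obtain ⟨D, hD⟩ := hXt.exists_glue
  obtain ⟨B, hB0, hB⟩ := exists_abs_le F
  -- Half of the constant is the gluing cost, half bounds `-2 * D * psi` when passing from `n + 2 *
  -- D` back to `n`.
  refine ⟨4 * D * B, by positivity, fun ν hν n hn => ?_⟩
  have hprob := hν.1
  have hne : ∀ m : ℕ, 0 < m → ∫ y : Y, blockMin X F m y.1 ∂ν ≤
      m * psi (X.shift.prodCongr Y.shift) Prod.snd f ν := by
    intro m hm
    -- Only the existence of a joining matters here: it makes the set under `sInf` nonempty.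
    obtain ⟨μ, hμ, hμν, -⟩ := exists_joining_integral_le hX hD hf hB hν hm
    have hm' : (0 : ℝ) < m := by exact_mod_cast hm
    rw [← div_le_iff₀' hm']
    refine le_csInf ⟨_, μ, ⟨hμ, hμν⟩, rfl⟩ ?_
    rintro _ ⟨ρ, ⟨hρ, rfl⟩, rfl⟩
    rw [div_le_iff₀' hm']
    exact integral_blockMin_le hf hρ m
  have hlow : ∀ m : ℕ, -(m * B) ≤ ∫ y : Y, blockMin X F m y.1 ∂ν := by
    intro m
    have h := integral_mono (integrable_const (-(m * B))) (integrable_blockMin X Y F m ν)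
      fun y => (abs_le.1 (abs_blockMin_le X hB m y.1)).1
    simpa using h
  have hpsi : -B ≤ psi (X.shift.prodCongr Y.shift) Prod.snd f ν := by
    have h1 := hne 1 one_pos
    have h2 := hlow 1
    push_cast at h1 h2
    linarith
  refine ⟨hne n hn, ?_⟩
  obtain ⟨μ, hμ, hμν, hle⟩ := exists_joining_integral_le hX hD hf hB hν hn
  have hbdd : BddBelow ((fun μ : Measure (X × Y) => ∫ z, f z ∂μ) ''
      {μ | μ ∈ invariantMeasures (X.shift.prodCongr Y.shift) ∧ μ.map Prod.snd = ν}) := by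
    refine ⟨∫ y : Y, blockMin X F 1 y.1 ∂ν, ?_⟩
    rintro _ ⟨ρ, ⟨hρ, rfl⟩, rfl⟩
    simpa using integral_blockMin_le hf hρ 1
  have h : psi (X.shift.prodCongr Y.shift) Prod.snd f ν ≤ ∫ z, f z ∂μ :=
    csInf_le hbdd ⟨μ, ⟨hμ, hμν⟩, rfl⟩
  have h' := mul_le_mul_of_nonneg_left h (Nat.cast_nonneg (α := ℝ) (n + 2 * D))
  have h'' := mul_le_mul_of_nonneg_left hpsi (show (0 : ℝ) ≤ 2 * D by positivity)
  push_cast at h' hle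
  linarith

/-- Along a periodic orbit the integral of the minimal cost is, up to an additive constant, its
value at a point of the orbit. -/
theorem abs_integral_blockMin_sub_le {B : ℝ} (hB0 : 0 ≤ B) (hB : ∀ a b, |F a b| ≤ B) {k : ℕ}
    (hk : 0 < k) (y : Y) (n : ℕ) :
    |∫ w : Y, blockMin X F n w.1 ∂averageMeasure Y.shift k (Measure.dirac y) -
      blockMin X F n y.1| ≤ 2 * B * k := by
  have hk' : (0 : ℝ) < k := by exact_mod_cast hk
  have h := integral_averageMeasure (μ := Measure.dirac y) Y.measurable_shift k
    (measurable_blockMin X Y F n) fun w => abs_blockMin_le X hB n w.1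
  have hm : Measurable fun z : Y => ∑ j ∈ Finset.range k, blockMin X F n (Y.shift^[j] z).1 :=
    Finset.measurable_fun_sum _ fun j _ =>
      (measurable_blockMin X Y F n).comp (Y.measurable_shift.iterate j)
  rw [integral_dirac' _ _ hm.stronglyMeasurable] at h
  refine le_of_mul_le_mul_left ?_ hk'
  rw [← abs_of_pos hk', ← abs_mul, abs_of_pos hk', mul_sub, h]
  have e : (k : ℝ) * blockMin X F n y.1 = ∑ j ∈ Finset.range k, blockMin X F n y.1 := by simp
  rw [e, ← Finset.sum_sub_distrib]
  refine (Finset.abs_sum_le_sum_abs _ _).trans ?_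
  have e' : (k : ℝ) * (2 * B * k) = ∑ j ∈ Finset.range k, 2 * B * k := by simp
  rw [e']
  refine Finset.sum_le_sum fun j hj => ?_
  have hs : (Y.shift^[j] y).1 = fun i => y.1 (i + j) := funext (Y.shift_iterate_apply y j)
  rw [hs]
  refine (abs_blockMin_translate_sub_le X hB n y.1 j).trans ?_
  have : (j : ℝ) ≤ k := by exact_mod_cast (Finset.mem_range.1 hj).le
  gcongr

omit [Finite A] [DiscreteTopology A] [BorelSpace A] in
theorem averageMeasure_dirac_mem_closedOrbitMeasures {k : ℕ} (hk : 0 < k) {y : Y}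
    (hy : Function.IsPeriodicPt Y.shift k y) :
    averageMeasure Y.shift k (Measure.dirac y) ∈ closedOrbitMeasures Y.shift := by
  refine ⟨averageMeasure_mem_invariantMeasures Y.measurable_shift hk ?_, k, hk, y, hy, rfl⟩
  rw [Measure.map_dirac' (Y.measurable_shift.iterate k), hy.eq]

end Bounds

/-! ### Ground states and maximizing measures -/

theorem sum_Icc_split (g : ℤ → ℝ) (D n : ℕ) :
    ∑ j ∈ Finset.Icc (-(D : ℤ)) (n - 1 + D), g j =
      ∑ j ∈ Finset.range n, g j +
        ∑ j ∈ Finset.Icc (-(D : ℤ)) (n - 1 + D) \ Finset.Ico 0 (n : ℤ), g j := by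
  have hsub : Finset.Ico 0 (n : ℤ) ⊆ Finset.Icc (-(D : ℤ)) (n - 1 + D) := by
    intro j hj
    rw [Finset.mem_Ico] at hj
    rw [Finset.mem_Icc]
    omega
  rw [← Finset.sum_sdiff hsub, add_comm]
  congr 1
  symm
  refine Finset.sum_nbij (fun j : ℕ => (j : ℤ)) (fun j hj => ?_) (fun i _ j _ h => ?_)
    (fun j hj => ?_) fun j _ => rfl
  · simpa using hj
  · exact Int.ofNat_inj.1 h
  · have hj' := Finset.mem_Ico.1 hj
    exact ⟨j.toNat, by simp; omega, by simp; omega⟩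

theorem abs_sum_Icc_sub_sum_range_le {A : Type*} {F : A → A → ℝ} {B : ℝ} (hB : ∀ a b, |F a b| ≤ B) (x y : ℤ → A) (D n : ℕ) :
    |∑ j ∈ Finset.Icc (-(D : ℤ)) (n - 1 + D), F (x j) (y j) -
      ∑ j ∈ Finset.range n, F (x j) (y j)| ≤ 2 * D * B := by
  rw [sum_Icc_split fun j => F (x j) (y j), add_sub_cancel_left]
  refine (abs_sum_cost_le hB _ x y).trans (le_of_eq ?_)
  have hsub : Finset.Ico 0 (n : ℤ) ⊆ Finset.Icc (-(D : ℤ)) (n - 1 + D) := by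
    intro j hj
    rw [Finset.mem_Ico] at hj
    rw [Finset.mem_Icc]
    omega
  have hcard : (Finset.Icc (-(D : ℤ)) (n - 1 + D) \ Finset.Ico 0 (n : ℤ)).card = 2 * D := by
    rw [Finset.card_sdiff_of_subset hsub, Int.card_Icc, Int.card_Ico]
    omega
  rw [hcard]
  push_cast
  ring

theorem concat_const_of_periodic {A : Type*} {u : ℤ → A} {p : ℤ} (hu : ∀ j, u (j + p) = u j) :
    (concat p fun _ => u) = u := by
  have hmul : ∀ (q r : ℤ), u (r + q * p) = u r := by
    intro q
    induction q using Int.induction_on with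
    | zero => simp
    | succ n ih => intro r; rw [add_one_mul, ← add_assoc, hu, ih]
    | pred n ih => intro r; rw [← ih r, ← hu (r + (-(n : ℤ) - 1) * p)]; congr 1; ring
  funext j
  rw [concat, ← hmul (j / p), Int.emod_add_ediv_mul]

section Equivalence

variable {A : Type*} [Finite A] [TopologicalSpace A] [DiscreteTopology A] [MeasurableSpace A]
  [BorelSpace A] {X Y : Subshift A} {f : C(X × Y, ℝ)} {F : A → A → ℝ}

omit [DiscreteTopology A] [MeasurableSpace A] [BorelSpace A] in
/-- A point whose minimal cost over `[0, n)` is much smaller than that of another point can be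
improved. -/
theorem exists_isImprovement (hXt : X.IsTransitive) (hYt : Y.IsTransitive)
    (hf : ∀ (x : X) (y : Y), f (x, y) = F (x.1 0) (y.1 0)) (C : ℝ) :
    ∃ K : ℝ, ∀ (n : ℕ), 0 < n → ∀ y z : Y, blockMin X F n y.1 + K < blockMin X F n z.1 →
      ∃ a b : ℤ, a ≤ b ∧ ∃ y' : Y, IsImprovement X Y f C a b y y' := by
  obtain ⟨D₁, hD₁⟩ := hXt.exists_glue
  obtain ⟨D₂, hD₂⟩ := hYt.exists_glue
  obtain ⟨B, hB0, hB⟩ := exists_abs_le F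
  set D := D₁ + D₂ with hD
  -- Each of the two comparisons below loses `2 * D * B` on the margins of width `D`; `C` remains as
  -- the required gain.
  refine ⟨4 * D * B + C, fun n hn y z hlt => ⟨-D, n - 1 + D, by omega, ?_⟩⟩
  obtain ⟨y', hy', h1, h2, h3⟩ := hD₂ y.1 y.2 z.1 z.2 y.1 y.2 (-D - 1) 0 (n - 1) (n + D)
    (by omega) (by omega) (by omega)
  refine ⟨⟨y', hy'⟩, fun j hj => ?_, fun v hv => ?_⟩
  · rw [Set.mem_Icc, not_and_or] at hj
    rcases hj with hj | hj
    · exact (h1 j (by omega)).symm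
    · exact (h3 j (by omega)).symm
  · have hlow : blockMin X F n z.1 - 2 * D * B ≤
        minSum X Y f (-D) (n - 1 + D) v ⟨y', hy'⟩ := by
      refine le_minSum hf hv fun x => ?_
      have e1 := (abs_le.1 (abs_sum_Icc_sub_sum_range_le hB x.1 y' D n)).1
      have e2 := blockMin_le X F n z.1 x.2
      have e3 : ∑ j ∈ Finset.range n, F (x.1 j) (z.1 j) =
          ∑ j ∈ Finset.range n, F (x.1 j) (y' j) :=
        Finset.sum_congr rfl fun j hj => by
          rw [h2 j (by omega) (by have := Finset.mem_range.1 hj; omega)]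
      linarith
    have hup : minSum X Y f (-D) (n - 1 + D) v y ≤ blockMin X F n y.1 + 2 * D * B := by
      obtain ⟨u, hu1, hu2⟩ := hv
      obtain ⟨x, hx, hmin⟩ := exists_eq_blockMin X F n y.1
      -- The outer pieces include the endpoints of the interval, so `w` has the prescribed end
      -- letters.
      obtain ⟨w, hw, g1, g2, g3⟩ := hD₁ u.1 u.2 x hx u.1 u.2 (-D) 0 (n - 1) (n - 1 + D)
        (by omega) (by omega) (by omega)
      have hle := minSum_le hf (-D) (n - 1 + D) y ⟨w, hw⟩
      simp only at hle
      rw [g1 _ le_rfl, g3 _ le_rfl, hu1, hu2] at hle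
      have e1 := (abs_le.1 (abs_sum_Icc_sub_sum_range_le hB w y.1 D n)).2
      have e3 : ∑ j ∈ Finset.range n, F (w j) (y.1 j) =
          ∑ j ∈ Finset.range n, F (x j) (y.1 j) :=
        Finset.sum_congr rfl fun j hj => by
          rw [g2 j (by omega) (by have := Finset.mem_range.1 hj; omega)]
      linarith
    linarith

theorem isAlphaMaximizing_of_mem_groundStates (hX : X.IsStepSFT 1) (hXt : X.IsTransitive)
    (hYt : Y.IsTransitive) (hf : ∀ (x : X) (y : Y), f (x, y) = F (x.1 0) (y.1 0)) {C : ℝ}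
    {y : Y} (hy : y ∈ groundStates X Y f C) {k : ℕ} (hk : 0 < k)
    (hper : Function.IsPeriodicPt Y.shift k y) :
    IsAlphaMaximizing (X.shift.prodCongr Y.shift) Y.shift Prod.snd f
      (averageMeasure Y.shift k (Measure.dirac y)) := by
  have hν₀ := (averageMeasure_dirac_mem_closedOrbitMeasures hk hper).1
  refine ⟨hν₀, fun ν hν => ?_⟩
  by_contra! hlt
  obtain ⟨K, hK⟩ := exists_isImprovement hXt hYt hf C
  obtain ⟨K', hK'0, hK'⟩ := exists_abs_mul_psi_sub_le (Y := Y) hX hXt hf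
  obtain ⟨B, hB0, hB⟩ := exists_abs_le F
  -- The maximum with `0` forces `n` to be positive.
  obtain ⟨n, hn⟩ := exists_lt_nsmul (sub_pos.2 hlt) (max (K + K' + 2 * B * k) 0)
  rw [nsmul_eq_mul] at hn
  have hn0 : 0 < n := by
    rcases Nat.eq_zero_or_pos n with rfl | h
    · simp at hn
    · exact h
  have hn' := (le_max_left _ _).trans_lt hn
  have hprob := hν.1
  -- Some point has a block minimum at least as large as the `ν`-average.
  obtain ⟨z, hz⟩ := exists_integral_le (integrable_blockMin X Y F n ν)
  have h1 := (hK' ν hν n hn0).2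
  have h2 := (hK' _ hν₀ n hn0).1
  have h3 := (abs_le.1 (abs_integral_blockMin_sub_le (X := X) hB0 hB hk y n)).1
  obtain ⟨a, b, hab, himp⟩ := hK n hn0 y z (by linarith)
  exact hy a b hab himp

omit [DiscreteTopology A] [MeasurableSpace A] [BorelSpace A] in
theorem IsImprovement.exists_gap {C : ℝ} (hC : 0 ≤ C) {a b : ℤ} {y y' : Y}
    (h : IsImprovement X Y f C a b y y') :
    ∃ δ > 0, ∀ v ∈ endpointPairs X a b, minSum X Y f a b v y + δ < minSum X Y f a b v y' := by
  have hne : (endpointPairs X a b).Nonempty := by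
    obtain ⟨x, hx⟩ := X.nonempty
    exact ⟨(x a, x b), ⟨x, hx⟩, rfl, rfl⟩
  obtain ⟨v, hv, hmin⟩ := Set.exists_min_image (endpointPairs X a b)
    (fun v => minSum X Y f a b v y' - minSum X Y f a b v y) (Set.toFinite _) hne
  have hpos := h.2 v hv
  refine ⟨(minSum X Y f a b v y' - minSum X Y f a b v y) / 2, by linarith, fun u hu => ?_⟩
  have := hmin u hu
  linarith

omit [DiscreteTopology A] [MeasurableSpace A] [BorelSpace A] in
-- After translation by `a - 1` the window `[a, b]` becomes `[1, b - a + 1]`, strictly between `0`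
-- and `p`. Replace `x` there by a cheap point for `y` with the same letters at the ends of the
-- window; outside it `y` and `y'` agree, so the gain is exactly that of the window.
theorem IsImprovement.exists_block (hX : X.IsStepSFT 1)
    (hf : ∀ (x : X) (y : Y), f (x, y) = F (x.1 0) (y.1 0)) {C : ℝ} (hC : 0 ≤ C) {a b : ℤ}
    {y y' : Y} (h : IsImprovement X Y f C a b y y') {p : ℕ} (hp : b - a + 1 < p) :
    ∃ δ > 0, ∀ x ∈ X.carrier, ∃ x' ∈ X.carrier, x' 0 = x 0 ∧ x' p = x p ∧
      ∑ j ∈ Finset.range p, F (x' j) (y.1 (j + (a - 1))) + δ ≤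
        ∑ j ∈ Finset.range p, F (x j) (y'.1 (j + (a - 1))) := by
  obtain ⟨δ, hδ, hgap⟩ := h.exists_gap hC
  refine ⟨δ, hδ, fun x hx => ?_⟩
  have hxa := X.translate_mem hx (1 - a)
  have hv : (x 1, x (b - a + 1)) ∈ endpointPairs X a b :=
    ⟨⟨_, hxa⟩, congrArg x (by ring), congrArg x (by ring)⟩
  have hle := minSum_le hf a b y' ⟨_, hxa⟩
  simp only [show a + (1 - a) = 1 by ring, show b + (1 - a) = b - a + 1 by ring] at hle
  obtain ⟨w, hwa, hwb, hw⟩ := exists_sum_lt_of_minSum_lt hf hv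
    (lt_sub_iff_add_lt.2 ((hgap _ hv).trans_le hle))
  simp only at hwa hwb
  have hwX := X.translate_mem w.2 (a - 1)
  have hmem := hX.splice_mem (c := 1) (d := b - a + 1) hx hwX
    (by rw [← hwa]; exact congrArg w.1 (by ring))
    (by rw [← hwb]; exact congrArg w.1 (by ring))
  refine ⟨_, hmem, ?_, ?_, ?_⟩
  · exact if_neg (by omega)
  · exact if_neg (by omega)
  · rw [← le_sub_iff_add_le', ← Finset.sum_sub_distrib]
    have hwin : ∑ j ∈ Finset.Icc a b,
        (F (x (j + (1 - a))) (y'.1 j) - F (w.1 j) (y.1 j)) =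
        ∑ j ∈ Finset.range p, (F (x j) (y'.1 (j + (a - 1))) -
          F (splice 1 (b - a + 1) x (fun j => w.1 (j + (a - 1))) j) (y.1 (j + (a - 1)))) := by
      refine Finset.sum_of_injOn (fun j => (j + (1 - a)).toNat) ?_ ?_ ?_ ?_
      · intro i hi j hj hij
        simp only [Finset.coe_Icc, Set.mem_Icc] at hi hj hij
        omega
      · intro i hi
        simp only [Finset.coe_Icc, Set.mem_Icc] at hi
        simp only [Finset.coe_range, Set.mem_Iio]
        omega
      · intro i hi hi'
        have hout : ¬(1 ≤ (i : ℤ) ∧ (i : ℤ) ≤ b - a + 1) := by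
          intro hi2
          refine hi' ⟨i + (a - 1), ?_, ?_⟩
          · simp only [Finset.coe_Icc, Set.mem_Icc]
            omega
          · simp only
            omega
        rw [splice, if_neg hout, h.1 _ (by rw [Set.mem_Icc]; omega), sub_self]
      · intro i hi
        rw [Finset.mem_Icc] at hi
        have e : (((i + (1 - a)).toNat : ℕ) : ℤ) = i + (1 - a) := by omega
        simp only [e]
        rw [splice, if_pos (by omega), show i + (1 - a) + (a - 1) = i by ring]
    rw [← hwin, Finset.sum_sub_distrib]
    linarith

theorem mem_groundStates_of_isAlphaMaximizing (hX : X.IsStepSFT 1) (hY : Y.IsStepSFT 1)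
    (hXt : X.IsTransitive) (hf : ∀ (x : X) (y : Y), f (x, y) = F (x.1 0) (y.1 0)) {C : ℝ}
    (hC : 0 ≤ C) {y : Y} {k : ℕ} (hk : 0 < k) (hper : Function.IsPeriodicPt Y.shift k y)
    (hmax : IsAlphaMaximizing (X.shift.prodCongr Y.shift) Y.shift Prod.snd f
      (averageMeasure Y.shift k (Measure.dirac y))) :
    y ∈ groundStates X Y f C := by
  rintro a b hab ⟨y', himp⟩
  -- A period of `y` that is long enough for the window to lie strictly inside one block.
  set p : ℕ := k * (b - a + 2).toNat with hp
  have hpos : 0 < (b - a + 2).toNat := by omega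
  have hp0 : 0 < p := Nat.mul_pos hk hpos
  have hpb : b - a + 1 < p := by
    have : (b - a + 2).toNat ≤ p := Nat.le_mul_of_pos_left _ hk
    omega
  have hyp : ∀ j, y.1 (j + p) = y.1 j :=
    (Y.isPeriodicPt_shift_iff y p).1 (hper.mul_const _)
  obtain ⟨δ, hδ, hblock⟩ := himp.exists_block hX hf hC hpb
  have hadd := blockMin_add_le_of_block (u := fun j => y.1 (j + (a - 1)))
    (t := fun j => y'.1 (j + (a - 1))) hX hp0 hblock
  rw [concat_const_of_periodic (p := (p : ℤ)) (u := fun j => y.1 (j + (a - 1)))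
    fun j => by rw [add_right_comm, hyp]] at hadd
  have ht := Y.translate_mem y'.2 (a - 1)
  -- The junction letters are those of `y'` at `a - 1` and `a - 1 + p`; both lie outside `[a, b]`,
  -- so they are letters of `y` and agree by periodicity.
  let z : Y := ⟨concat p fun _ => fun j => y'.1 (j + (a - 1)),
    hY.concat_mem (by exact_mod_cast hp0) _ (fun _ => ht) fun _ => by
      rw [← himp.1 _ (by rw [Set.mem_Icc]; omega), ← himp.1 _ (by rw [Set.mem_Icc]; omega),
        add_comm, hyp, zero_add]⟩
  have hz : Function.IsPeriodicPt Y.shift p z := by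
    rw [Y.isPeriodicPt_shift_iff]
    intro j
    simp only [z, concat]
    rw [Int.add_emod_right]
  obtain ⟨K, hK0, hK⟩ := exists_abs_mul_psi_sub_le (Y := Y) hX hXt hf
  obtain ⟨B, hB0, hB⟩ := exists_abs_le F
  have hν := (averageMeasure_dirac_mem_closedOrbitMeasures hp0 hz).1
  -- The errors collected are `K` from `psi`, one for each of the two periodic orbits, and one for
  -- the translation of `y` by `a - 1`. None depends on `L`, so the gain `L * δ` outgrows them.
  obtain ⟨L, hL⟩ := exists_lt_nsmul hδ
    (max (K + 2 * B * k + 2 * B * p + 2 * B * |((a - 1 : ℤ) : ℝ)|) 0)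
  rw [nsmul_eq_mul] at hL
  have hL0 : 0 < L := by
    rcases Nat.eq_zero_or_pos L with rfl | h
    · simp at hL
    · exact h
  have hL' := (le_max_left _ _).trans_lt hL
  have hLp : 0 < L * p := Nat.mul_pos hL0 hp0
  have h1 := (hK _ hmax.1 (L * p) hLp).2
  have h2 := (hK _ hν (L * p) hLp).1
  have h3 := (abs_le.1 (abs_integral_blockMin_sub_le (X := X) hB0 hB hk y (L * p))).2
  have h4 := (abs_le.1 (abs_integral_blockMin_sub_le (X := X) hB0 hB hp0 z (L * p))).1
  have h5 := (abs_le.1 (abs_blockMin_translate_int_sub_le X hB (L * p) y.1 (a - 1))).1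
  have h6 := mul_le_mul_of_nonneg_left (hmax.2 _ hν) (Nat.cast_nonneg (α := ℝ) (L * p))
  have h7 := hadd L
  have h8 : blockMin X F (L * p) z.1 =
    blockMin X F (L * p) (concat p fun _ => fun j => y'.1 (j + (a - 1))) := rfl
  push_cast at *
  linarith

end Equivalence

end AdversarialErgodic
end

open AdversarialErgodic
theorem mainTheorem11 {A : Type*} [Finite A] [TopologicalSpace A] [DiscreteTopology A]
    [MeasurableSpace A] [BorelSpace A] (X Y : Subshift A)
    (hX : X.IsStepSFT 1) (hY : Y.IsStepSFT 1) (hXt : X.IsTransitive) (hYt : Y.IsTransitive)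
    (f : C(X × Y, ℝ)) (hf : ∃ F : A → A → ℝ, ∀ (x : X) (y : Y), f (x, y) = F (x.1 0) (y.1 0))
    (C : ℝ) (hC : 0 ≤ C) :
    (∃ ν₀ ∈ closedOrbitMeasures Y.shift,
        IsAlphaMaximizing (X.shift.prodCongr Y.shift) Y.shift Prod.snd f ν₀) ↔
      ∃ y ∈ groundStates X Y f C, y ∈ Function.periodicPts Y.shift := by
  obtain ⟨F, hF⟩ := hf
  constructor
  · rintro ⟨_, ⟨-, k, hk, y, hy, rfl⟩, hmax⟩
    exact ⟨y, mem_groundStates_of_isAlphaMaximizing hX hY hXt hF hC hk hy hmax, k, hk, hy⟩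
  · rintro ⟨y, hy, k, hk, hper⟩
    exact ⟨_, averageMeasure_dirac_mem_closedOrbitMeasures hk hper,
      isAlphaMaximizing_of_mem_groundStates hX hXt hYt hF hy hk hper⟩
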